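/- Let $N\ge 2$, let $\Omega\subset\mathbb{R}^N$ be a bounded Lipschitz domain, and let $0<s<1<p<N/s$. For measurable $u:\mathbb{R}^N\to\mathbb{R}$ put $$[u]_{s,p}=\Big(\int_{\mathbb{R}^N}\int_{\mathbb{R}^N}\frac{|u(x)-u(y)|^p}{|x-y|^{N+sp}}\,dx\,dy\Big)^{1/p},$$ write $|u|_q$ for the $L^q$ norm ($1\le q\le\infty$), and let $W_0^{s,p}(\Omega)$ be the closure of $C_0^\infty(\Omega)$ (functions extended by zero to $\mathbb{R}^N$) with respect to the norm $[u]_{s,p}+|u|_p$. A function $u\in W_0^{s,p}(\Omega)$ is a weak solution of $(-\Delta)_p^s u=f$ in $\Omega$, $u=0$ in $\mathbb{R}^N\setminus\Omega$, if for all $\varphi\in W_0^{s,p}(\Omega)$ $$\int_{\mathbb{R}^N}\int_{\mathbb{R}^N}\frac{|u(x)-u(y)|^{p-2}(u(x)-u(y))(\varphi(x)-\varphi(y))}{|x-y|^{N+sp}}\,dx\,dy=\int_\Omega f\varphi\,dx .$$ Let $\lambda_{1,p}^s(\Omega)=\inf\{[u]_{s,p}^p : u\in W_0^{s,p}(\Omega),\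 |u|_p=1\}$ be the first eigenvalue. Let $\phi_p^s$ be the $(s,p)$-torsion function of $\Omega$, i.e. the weak solution for $f\equiv 1$, and let $e_p^s$ be the normalized first eigenfunction, i.e. the weak solution for $f=\lambda_{1,p}^s(\Omega)(e_p^s)^{p-1}$ with $e_p^s>0$ a.e. in $\Omega$ and $|e_p^s|_\infty=1$. Then $$e_p^s\le \lambda_{1,p}^s(\Omega)^{\frac1{p-1}}\,\phi_p^s\quad\text{a.e. in }\Omega,$$ $$\frac{1}{|\phi_p^s|_\infty^{p-1}}\le\lambda_{1,p}^s(\Omega)\le\frac{|\Omega|^{p-1}}{|\phi_p^s|_1^{p-1}},$$ and $\phi_p^s>0$ a.e. in $\Omega$. -/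

import Mathlib

open MeasureTheory Filter Topology
open scoped ContDiff

noncomputable section

namespace FracTorsion

/-- Euclidean space `ℝ^N`. -/
abbrev E (N : ℕ) : Type := EuclideanSpace ℝ (Fin N)

/-- A bounded Lipschitz domain: a nonempty, open, connected, bounded set which, near each boundary
point, is the strict epigraph of a Lipschitz function in some orthogonal coordinate system.
Here `ν` is the unit vector of the vertical axis, `inner ℝ ν x` is the height of `x`, and
`x - inner ℝ ν x • ν` is the projection of `x` to the hyperplane orthogonal to `ν`. -/
structure IsBoundedLipschitzDomain {N : ℕ} (Ω : Set (E N)) : Prop where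
  isOpen : IsOpen Ω
  isConnected : IsConnected Ω
  isBounded : Bornology.IsBounded Ω
  lipschitz_boundary : ∀ x₀ ∈ frontier Ω, ∃ ν : E N, ‖ν‖ = 1 ∧ ∃ (K : NNReal) (g : E N → ℝ),
    LipschitzWith K g ∧
      ∀ᶠ x in 𝓝 x₀, x ∈ Ω ↔ g (x - inner ℝ ν x • ν) < inner ℝ ν x

/-- The `p`-th power `[u]_{s,p}^p` of the Gagliardo seminorm on `ℝ^N`, with values in `[0, ∞]`. -/
def gagliardoPow {N : ℕ} (s p : ℝ) (u : E N → ℝ) : ENNReal :=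
  ∫⁻ z : E N × E N,
    ENNReal.ofReal (|u z.1 - u z.2| ^ p / ‖z.1 - z.2‖ ^ ((N : ℝ) + s * p))
      ∂((volume : Measure (E N)).prod volume)

/-- The Gagliardo seminorm `[u]_{s,p}` on `ℝ^N`. -/
def gagliardo {N : ℕ} (s p : ℝ) (u : E N → ℝ) : ENNReal :=
  gagliardoPow s p u ^ (1 / p)

/-- The norm `[u]_{s,p} + |u|_p`. -/
def sobolevNorm {N : ℕ} (s p : ℝ) (u : E N → ℝ) : ENNReal :=
  gagliardo s p u + eLpNorm u (ENNReal.ofReal p) volume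

/-- `C_0^∞(Ω)`: smooth functions with compact support contained in `Ω`. -/
structure IsTestFunction {N : ℕ} (Ω : Set (E N)) (ψ : E N → ℝ) : Prop where
  contDiff : ContDiff ℝ ∞ ψ
  hasCompactSupport : HasCompactSupport ψ
  tsupport_subset : tsupport ψ ⊆ Ω

/-- `u ∈ W_0^{s,p}(Ω)`: the (measurable) function `u` on `ℝ^N` is in the closure of `C_0^∞(Ω)`
with respect to the norm `[·]_{s,p} + |·|_p`. -/
structure MemW0 {N : ℕ} (s p : ℝ) (Ω : Set (E N)) (u : E N → ℝ) : Prop where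
  aestronglyMeasurable : AEStronglyMeasurable u volume
  mem_closure : ∀ ε : ENNReal, 0 < ε →
    ∃ ψ : E N → ℝ, IsTestFunction Ω ψ ∧ sobolevNorm s p (fun x => u x - ψ x) < ε

/-- The pairing `⟨(-Δ)_p^s u, φ⟩`. -/
def fracPairing {N : ℕ} (s p : ℝ) (u φ : E N → ℝ) : ℝ :=
  ∫ z : E N × E N,
    |u z.1 - u z.2| ^ (p - 2) * (u z.1 - u z.2) * (φ z.1 - φ z.2)
      / ‖z.1 - z.2‖ ^ ((N : ℝ) + s * p)
      ∂((volume : Measure (E N)).prod volume)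

/-- `u` is a weak solution of `(-Δ)_p^s u = f` in `Ω`, `u = 0` in `ℝ^N ∖ Ω`. -/
structure IsWeakSolution {N : ℕ} (s p : ℝ) (Ω : Set (E N)) (f u : E N → ℝ) : Prop where
  memW0 : MemW0 s p Ω u
  weak : ∀ φ : E N → ℝ, MemW0 s p Ω φ → fracPairing s p u φ = ∫ x in Ω, f x * φ x

/-- `φ` is the `(s,p)`-torsion function of `Ω`. -/
def IsTorsionFunction {N : ℕ} (s p : ℝ) (Ω : Set (E N)) (φ : E N → ℝ) : Prop :=
  IsWeakSolution s p Ω (fun _ => 1) φ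

/-- The first eigenvalue `λ_{1,p}^s(Ω)`, through its variational definition. -/
def firstEigenvalue {N : ℕ} (s p : ℝ) (Ω : Set (E N)) : ENNReal :=
  sInf {a | ∃ u : E N → ℝ, MemW0 s p Ω u ∧
    eLpNorm u (ENNReal.ofReal p) (volume.restrict Ω) = 1 ∧ a = gagliardoPow s p u}

/-- `e` is the positive first eigenfunction of `Ω`, normalized by `|e|_∞ = 1`. -/
structure IsNormalizedFirstEigenfunction {N : ℕ} (s p : ℝ) (Ω : Set (E N)) (e : E N → ℝ) :
    Prop where
  isWeakSolution :
    IsWeakSolution s p Ω (fun x => (firstEigenvalue s p Ω).toReal * e x ^ (p - 1)) e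
  pos : ∀ᵐ x ∂(volume.restrict Ω), 0 < e x
  norm_eq_one : eLpNorm e ⊤ (volume.restrict Ω) = 1

end FracTorsion

end

/-!
Testing the eigenvalue equation and the torsion equation with `(e - λ^{1/(p-1)} φ)⁺` gives
`e ≤ λ^{1/(p-1)} φ`, because `λ e^{p-1} ≤ λ` and the operator is strictly monotone. For the rest,
the torsion equation tested with `|u|^p / (φ + ε)^{p-1}` and Picone's inequality
`|a - b|^{p-2} (a - b) (c^p / a^{p-1} - d^p / b^{p-1}) ≤ |c - d|^p` give, as `ε → 0`,
`∫_Ω |u|^p / φ^{p-1} ≤ [u]_{s,p}^p` for every `u` in `W_0^{s,p}(Ω)`. Finiteness of the left-hand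
side for test functions `u` forces `φ > 0`, and bounding `φ` by `|φ|_∞` yields the lower bound on
`λ`. The upper bound is Hölder's inequality for the competitor `φ`, as `[φ]_{s,p}^p = |φ|_1`.

All test functions used here are of the form `F(u, v)` with `F` Lipschitz and `F(0, 0) = 0`. They
are in `W_0^{s,p}(Ω)` since `F` can be mollified and `u`, `v` approximated by smooth functions; the
resulting increments converge in `L^p` by dominated convergence.
-/

noncomputable section

namespace FracTorsion

/-! ### Odd powers and Picone's inequality -/

section RealInequalities

variable {p : ℝ}

/-- The odd power `|t|^(p-2) t`, which is the nonlinearity of the `p`-Laplacian. -/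
def signedPow (p t : ℝ) : ℝ := |t| ^ (p - 2) * t

lemma signedPow_of_nonneg (hp : p ≠ 1) {t : ℝ} (ht : 0 ≤ t) : signedPow p t = t ^ (p - 1) := by
  have hp' : p - 2 + 1 ≠ 0 := fun h => hp (by linarith)
  rw [signedPow, abs_of_nonneg ht, ← Real.rpow_add_one' ht hp']
  ring_nf

lemma signedPow_neg (p t : ℝ) : signedPow p (-t) = -signedPow p t := by
  simp [signedPow]

lemma abs_signedPow (hp : p ≠ 1) (t : ℝ) : |signedPow p t| = |t| ^ (p - 1) := by
  rw [← signedPow_of_nonneg hp (abs_nonneg t)]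
  simp [signedPow, abs_mul, abs_of_nonneg (Real.rpow_nonneg (abs_nonneg t) (p - 2))]

lemma signedPow_mul_self (hp : p ≠ 0) (t : ℝ) : signedPow p t * t = |t| ^ p := by
  have hp' : p - 2 + (2 : ℕ) ≠ 0 := by simpa using hp
  rw [signedPow, mul_assoc, ← sq, ← sq_abs, ← Real.rpow_add_natCast' (abs_nonneg t) hp']
  simp

lemma signedPow_mul (hp : p ≠ 1) {c : ℝ} (hc : 0 ≤ c) (t : ℝ) :
    signedPow p (c * t) = c ^ (p - 1) * signedPow p t := by
  rw [← signedPow_of_nonneg hp hc, signedPow, signedPow, signedPow, abs_mul,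
    Real.mul_rpow (abs_nonneg c) (abs_nonneg t)]
  ring

lemma strictMono_signedPow (hp : 1 < p) : StrictMono (signedPow p) := by
  refine strictMono_of_odd_strictMonoOn_nonneg (signedPow_neg p) fun a ha b hb hab => ?_
  rw [signedPow_of_nonneg hp.ne' ha, signedPow_of_nonneg hp.ne' hb]
  exact Real.rpow_lt_rpow ha hab (sub_pos.2 hp)

lemma abs_signedPow_mul_le (hp : 1 < p) (a b : ℝ) :
    |signedPow p a * b| ≤ |a| ^ p + |b| ^ p := by
  set m := max |a| |b|
  have hm : 0 ≤ m := (abs_nonneg a).trans (le_max_left _ _)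
  have hp' : p - 1 + 1 ≠ 0 := by linarith
  calc |signedPow p a * b| = |a| ^ (p - 1) * |b| := by rw [abs_mul, abs_signedPow hp.ne']
    _ ≤ m ^ (p - 1) * m := by
      gcongr
      exacts [le_max_left _ _, le_max_right _ _]
    _ = m ^ p := by rw [← Real.rpow_add_one' hm hp', sub_add_cancel]
    _ ≤ |a| ^ p + |b| ^ p := by
      have := Real.rpow_nonneg (abs_nonneg a) p
      have := Real.rpow_nonneg (abs_nonneg b) p
      rcases max_choice |a| |b| with h | h <;> simp only [m, h] <;> linarith

lemma mul_sub_nonneg_of_sub_eq_sub {f g : ℝ → ℝ} (hf : Monotone f) (hg : Monotone g)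
    {a b x y : ℝ} (h : a - b = x - y) : 0 ≤ (f a - f b) * (g x - g y) := by
  rcases le_total a b with hab | hab
  · exact mul_nonneg_of_nonpos_of_nonpos (sub_nonpos.2 (hf hab))
      (sub_nonpos.2 (hg (by linarith)))
  · exact mul_nonneg (sub_nonneg.2 (hf hab)) (sub_nonneg.2 (hg (by linarith)))

lemma eq_of_mul_sub_eq_zero {f : ℝ → ℝ} (g : ℝ → ℝ) (hf : f.Injective)
    {a b x y : ℝ} (h : a - b = x - y) (h0 : (f a - f b) * (g x - g y) = 0) : g x = g y := by
  rcases mul_eq_zero.1 h0 with h0 | h0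
  · rw [show x = y by linarith [hf (sub_eq_zero.1 h0)]]
  · exact sub_eq_zero.1 h0

-- This is convexity of `t ^ p` at the points `x / a` and `y / b` with weights `a` and `b`.
lemma add_rpow_div_add_rpow_le (hp : 1 ≤ p) {x y a b : ℝ} (hx : 0 ≤ x) (hy : 0 ≤ y)
    (ha : 0 < a) (hb : 0 < b) :
    (x + y) ^ p / (a + b) ^ (p - 1) ≤ x ^ p / a ^ (p - 1) + y ^ p / b ^ (p - 1) := by
  have perspective : ∀ {c t : ℝ}, 0 < c → 0 ≤ t → c * (t / c) ^ p = t ^ p / c ^ (p - 1) := by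
    intro c t hc ht
    have : 0 < c ^ p := by positivity
    rw [Real.div_rpow ht hc.le, Real.rpow_sub_one hc.ne']
    field_simp
  have hxa : x / a ∈ Set.Ici (0 : ℝ) := div_nonneg hx ha.le
  have hyb : y / b ∈ Set.Ici (0 : ℝ) := div_nonneg hy hb.le
  have hconv := (convexOn_rpow hp).2 hxa hyb (by positivity : 0 ≤ a / (a + b))
    (by positivity : 0 ≤ b / (a + b)) (by field_simp)
  have hmean : a / (a + b) * (x / a) + b / (a + b) * (y / b) = (x + y) / (a + b) := by field_simp
  simp only [smul_eq_mul, hmean] at hconv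
  rw [← perspective (by positivity) (by positivity), ← perspective ha hx, ← perspective hb hy]
  calc (a + b) * ((x + y) / (a + b)) ^ p
      ≤ (a + b) * (a / (a + b) * (x / a) ^ p + b / (a + b) * (y / b) ^ p) := by gcongr
    _ = a * (x / a) ^ p + b * (y / b) ^ p := by field_simp

lemma discrete_picone_of_lt (hp : 1 < p) {a b A B : ℝ} (hb : 0 < b) (hab : b < a) (hA : 0 ≤ A)
    (hB : 0 ≤ B) :
    signedPow p (a - b) * (A ^ p / a ^ (p - 1) - B ^ p / b ^ (p - 1)) ≤ |A - B| ^ p := by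
  have hd : 0 < a - b := sub_pos.2 hab
  have hpow : 0 < (a - b) ^ (p - 1) := by positivity
  have ha : 0 < a := hb.trans hab
  have hsum : A ^ p / a ^ (p - 1) ≤ |A - B| ^ p / (a - b) ^ (p - 1) + B ^ p / b ^ (p - 1) :=
    calc A ^ p / a ^ (p - 1) ≤ (|A - B| + B) ^ p / (a - b + b) ^ (p - 1) := by
          rw [sub_add_cancel]
          gcongr
          linarith [le_abs_self (A - B)]
      _ ≤ _ := add_rpow_div_add_rpow_le hp.le (abs_nonneg _) hB hd hb
  rw [signedPow_of_nonneg hp.ne' hd.le, mul_comm, ← le_div_iff₀ hpow]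
  linarith

lemma discrete_picone (hp : 1 < p) {a b A B : ℝ} (ha : 0 < a) (hb : 0 < b) (hA : 0 ≤ A)
    (hB : 0 ≤ B) :
    signedPow p (a - b) * (A ^ p / a ^ (p - 1) - B ^ p / b ^ (p - 1)) ≤ |A - B| ^ p := by
  rcases lt_trichotomy a b with h | rfl | h
  · have hswap := discrete_picone_of_lt hp ha h hB hA
    rw [← neg_sub a b, signedPow_neg, abs_sub_comm B A] at hswap
    linarith
  · rw [sub_self, signedPow, mul_zero, zero_mul]
    positivity
  · exact discrete_picone_of_lt hp hb h hA hB

end RealInequalities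

/-! ### Lipschitz functions -/

section Lipschitz

open scoped NNReal

lemma lipschitzWith_mul_of_norm_le {α R : Type*} [PseudoMetricSpace α] [SeminormedRing R]
    {f g : α → R} {C D A B : ℝ≥0} (hf : LipschitzWith C f) (hg : LipschitzWith D g)
    (hfA : ∀ x, ‖f x‖ ≤ A) (hgB : ∀ x, ‖g x‖ ≤ B) :
    LipschitzWith (C * B + A * D) fun x => f x * g x := by
  refine LipschitzWith.of_dist_le_mul fun x y => ?_
  have hfxy : ‖f x - f y‖ ≤ C * dist x y := by simpa [dist_eq_norm] using hf.dist_le_mul x y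
  have hgxy : ‖g x - g y‖ ≤ D * dist x y := by simpa [dist_eq_norm] using hg.dist_le_mul x y
  calc dist (f x * g x) (f y * g y) = ‖(f x - f y) * g x + f y * (g x - g y)‖ := by
        rw [dist_eq_norm]; noncomm_ring
    _ ≤ ‖f x - f y‖ * ‖g x‖ + ‖f y‖ * ‖g x - g y‖ :=
        (norm_add_le _ _).trans (add_le_add (norm_mul_le _ _) (norm_mul_le _ _))
    _ ≤ C * dist x y * B + A * (D * dist x y) := by
        gcongr
        exacts [hgB x, hfA y]
    _ = (C * B + A * D : ℝ≥0) * dist x y := by push_cast; ring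

lemma exists_lipschitzWith_min_abs_rpow {p k : ℝ} (hp : 1 ≤ p) (hk : 0 ≤ k) :
    ∃ C, LipschitzWith C fun a : ℝ => min |a| k ^ p := by
  have hsmooth : ContDiff ℝ 1 fun t : ℝ => t ^ p :=
    Real.contDiff_rpow_const_of_le (by simpa using hp)
  obtain ⟨C, hC⟩ := hsmooth.contDiffOn.exists_lipschitzOnWith one_ne_zero (convex_Icc 0 k)
    isCompact_Icc
  have hmin : LipschitzWith 1 fun a : ℝ => min |a| k := lipschitzWith_one_norm.min_const k
  exact ⟨_, lipschitzOnWith_univ.1 (hC.comp (lipschitzOnWith_univ.2 hmin)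
    fun a _ => ⟨le_min (abs_nonneg a) hk, min_le_right _ _⟩)⟩

lemma lipschitzOnWith_rpow_Ici {r ε : ℝ} (hr : r ≤ 1) (hε : 0 < ε) :
    LipschitzOnWith (Real.nnabs r * (Real.toNNReal ε) ^ (r - 1)) (fun t : ℝ => t ^ r)
      (Set.Ici ε) := by
  refine (convex_Ici ε).lipschitzOnWith_of_nnnorm_hasDerivWithin_le
    (fun t ht => (Real.hasDerivAt_rpow_const (Or.inl (hε.trans_le ht).ne')).hasDerivWithinAt)
    fun t ht => ?_
  have ht0 : 0 < t := hε.trans_le ht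
  rw [← NNReal.coe_le_coe]
  push_cast
  rw [norm_mul, Real.norm_eq_abs, Real.norm_of_nonneg (Real.rpow_nonneg ht0.le _),
    Real.coe_toNNReal ε hε.le]
  exact mul_le_mul_of_nonneg_left (Real.rpow_le_rpow_of_nonpos hε ht (sub_nonpos.2 hr))
    (abs_nonneg r)

lemma exists_lipschitzWith_inv_max_add_rpow {r ε : ℝ} (hr : 0 ≤ r) (hε : 0 < ε) :
    ∃ D, LipschitzWith D fun b : ℝ => ((max b 0 + ε) ^ r)⁻¹ := by
  have hmax : LipschitzWith (1 + 0) fun b : ℝ => max b 0 + ε :=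
    (LipschitzWith.id.max_const 0).add (LipschitzWith.const ε)
  have hmaps : ∀ b : ℝ, ε ≤ max b 0 + ε := fun b => le_add_of_nonneg_left (le_max_right b 0)
  simp only [← Real.rpow_neg (hε.le.trans (hmaps _))]
  exact ⟨_, lipschitzOnWith_univ.1 ((lipschitzOnWith_rpow_Ici (by linarith) hε).comp
    (lipschitzOnWith_univ.2 hmax) fun b _ => hmaps b)⟩

open scoped Convolution in
lemma lipschitzWith_normed_convolution {V W : Type*} [NormedAddCommGroup V] [NormedSpace ℝ V]
    [FiniteDimensional ℝ V] [MeasurableSpace V] [BorelSpace V] [NormedAddCommGroup W]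
    [NormedSpace ℝ W] {μ : Measure V} [μ.IsAddHaarMeasure] (η : ContDiffBump (0 : V)) {K : ℝ≥0}
    {F : V → W} (hF : LipschitzWith K F) :
    LipschitzWith K (η.normed μ ⋆[ContinuousLinearMap.lsmul ℝ ℝ, μ] F) := by
  have hint : ∀ x, Integrable (fun t => η.normed μ t • F (x - t)) μ := fun x =>
    (η.continuous_normed.smul (hF.continuous.comp (by fun_prop))).integrable_of_hasCompactSupport
      η.hasCompactSupport_normed.smul_right
  refine LipschitzWith.of_dist_le_mul fun x y => ?_
  simp only [convolution_def, ContinuousLinearMap.lsmul_apply]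
  rw [dist_eq_norm, ← integral_sub (hint x) (hint y)]
  calc ‖∫ t, (η.normed μ t • F (x - t) - η.normed μ t • F (y - t)) ∂μ‖
      ≤ ∫ t, η.normed μ t * (K * dist x y) ∂μ := by
        refine norm_integral_le_of_norm_le (η.integrable_normed.mul_const _)
          (.of_forall fun t => ?_)
        rw [← smul_sub, norm_smul, Real.norm_of_nonneg (η.nonneg_normed t), ← dist_eq_norm]
        refine mul_le_mul_of_nonneg_left ?_ (η.nonneg_normed t)
        simpa using hF.dist_le_mul (x - t) (y - t)
    _ = K * dist x y := by rw [integral_mul_const, η.integral_normed, one_mul]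

open scoped Convolution in
lemma exists_contDiff_lipschitzWith_dist_le {V W : Type*} [NormedAddCommGroup V]
    [NormedSpace ℝ V] [FiniteDimensional ℝ V] [NormedAddCommGroup W] [NormedSpace ℝ W]
    [CompleteSpace W] {K : ℝ≥0} {F : V → W} (hF : LipschitzWith K F) {ε : ℝ} (hε : 0 < ε) :
    ∃ H : V → W, ContDiff ℝ ∞ H ∧ LipschitzWith K H ∧ ∀ x, dist (H x) (F x) ≤ ε := by
  borelize V
  let μ : Measure V := Measure.addHaar
  let δ : ℝ := ε / (K + 1)
  have hδ : 0 < δ := by positivity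
  have hKδ : K * δ ≤ ε := by
    rw [mul_div_assoc', div_le_iff₀ (by positivity)]
    nlinarith [K.2]
  let η : ContDiffBump (0 : V) := ⟨δ / 2, δ, by positivity, by linarith⟩
  refine ⟨η.normed μ ⋆[ContinuousLinearMap.lsmul ℝ ℝ, μ] F, ?_,
    lipschitzWith_normed_convolution η hF, fun x => ?_⟩
  · exact η.hasCompactSupport_normed.contDiff_convolution_left _ η.contDiff_normed
      hF.continuous.locallyIntegrable
  · refine η.dist_normed_convolution_le hF.continuous.aestronglyMeasurable fun y hy => ?_
    exact (hF.dist_le_mul y x).trans ((mul_le_mul_of_nonneg_left hy.le K.2).trans hKδ)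

lemma exists_contDiff_lipschitzWith_dist_le_of_map_zero {V W : Type*} [NormedAddCommGroup V]
    [NormedSpace ℝ V] [FiniteDimensional ℝ V] [NormedAddCommGroup W] [NormedSpace ℝ W]
    [CompleteSpace W] {K : ℝ≥0} {F : V → W} (hF : LipschitzWith K F) (hF0 : F 0 = 0) {ε : ℝ}
    (hε : 0 < ε) :
    ∃ H : V → W, ContDiff ℝ ∞ H ∧ LipschitzWith K H ∧ H 0 = 0 ∧ ∀ x, dist (H x) (F x) ≤ ε := by
  obtain ⟨H, hsmooth, hlip, hdist⟩ := exists_contDiff_lipschitzWith_dist_le hF (half_pos hε)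
  refine ⟨fun x => H x - H 0, hsmooth.sub contDiff_const, ?_, sub_self _, fun x => ?_⟩
  · exact LipschitzWith.of_dist_le_mul fun x y => by simpa using hlip.dist_le_mul x y
  · calc dist (H x - H 0) (F x) = dist (H x - H 0) (F x - F 0) := by rw [hF0, sub_zero]
      _ ≤ dist (H x) (F x) + dist (H 0) (F 0) := dist_sub_sub_le _ _ _ _
      _ ≤ ε / 2 + ε / 2 := add_le_add (hdist x) (hdist 0)
      _ = ε := add_halves ε

lemma exists_seq_contDiff_lipschitzWith_tendstoUniformly_of_map_zero {V W : Type*}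
    [NormedAddCommGroup V] [NormedSpace ℝ V] [FiniteDimensional ℝ V] [NormedAddCommGroup W]
    [NormedSpace ℝ W] [CompleteSpace W] {K : ℝ≥0} {F : V → W} (hF : LipschitzWith K F)
    (hF0 : F 0 = 0) :
    ∃ H : ℕ → V → W, (∀ n, ContDiff ℝ ∞ (H n)) ∧ (∀ n, LipschitzWith K (H n)) ∧
      (∀ n, H n 0 = 0) ∧ TendstoUniformly H F atTop := by
  choose H hsmooth hlip hzero hdist using fun n : ℕ =>
    exists_contDiff_lipschitzWith_dist_le_of_map_zero hF hF0 (Nat.one_div_pos_of_nat (n := n))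
  refine ⟨H, hsmooth, hlip, hzero, Metric.tendstoUniformly_iff.2 fun ε hε => ?_⟩
  filter_upwards [tendsto_one_div_add_atTop_nhds_zero_nat.eventually_lt_const hε] with n hn x
  exact (dist_comm _ _).trans_lt ((hdist n x).trans_lt hn)

end Lipschitz

/-! ### Convergence in `L^q` -/

section Lq

variable {α V W : Type*} [MeasurableSpace α] {μ : Measure α} [NormedAddCommGroup V]
  [NormedAddCommGroup W] {q : ENNReal}

lemma eLpNorm_ofReal_rpow {p : ℝ} (hp : 0 < p) (f : α → V) :
    eLpNorm f (ENNReal.ofReal p) μ ^ p = ∫⁻ x, ‖f x‖ₑ ^ p ∂μ := by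
  rw [eLpNorm_eq_lintegral_rpow_enorm_toReal (by simpa using hp) ENNReal.ofReal_ne_top,
    ENNReal.toReal_ofReal hp.le, ← ENNReal.rpow_mul, one_div_mul_cancel hp.ne', ENNReal.rpow_one]

lemma integrable_abs_rpow {p : ℝ} (hp : 0 < p) {f : α → ℝ} (hf : MemLp f (ENNReal.ofReal p) μ) :
    Integrable (fun x => |f x| ^ p) μ := by
  simpa [ENNReal.toReal_ofReal hp.le] using
    hf.integrable_norm_rpow (by simpa using hp) ENNReal.ofReal_ne_top

lemma integrable_signedPow_mul {p : ℝ} (hp : 1 < p) {f g : α → ℝ}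
    (hf : MemLp f (ENNReal.ofReal p) μ) (hg : MemLp g (ENNReal.ofReal p) μ) :
    Integrable (fun x => signedPow p (f x) * g x) μ := by
  have hp0 : 0 < p := one_pos.trans hp
  refine ((integrable_abs_rpow hp0 hf).add (integrable_abs_rpow hp0 hg)).mono' ?_
    (.of_forall fun x => abs_signedPow_mul_le hp (f x) (g x))
  have hfm := hf.1.aemeasurable
  exact (((hfm.abs.pow_const (p - 2)).mul hfm).mul hg.1.aemeasurable).aestronglyMeasurable

lemma ofReal_integral_eq_eLpNorm_one {f : α → ℝ} (hf : Integrable f μ) (hf0 : 0 ≤ᵐ[μ] f) :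
    ENNReal.ofReal (∫ x, f x ∂μ) = eLpNorm f 1 μ := by
  rw [ofReal_integral_eq_lintegral_ofReal hf hf0, eLpNorm_one_eq_lintegral_enorm]
  exact lintegral_congr_ae (hf0.mono fun x hx => (Real.enorm_of_nonneg hx).symm)

lemma eLpNorm_ne_zero_of_ae_pos [NeZero μ] {f : α → ℝ} (hf : AEStronglyMeasurable f μ)
    (hpos : ∀ᵐ x ∂μ, 0 < f x) (hq : q ≠ 0) : eLpNorm f q μ ≠ 0 := fun h => by
  obtain ⟨x, hx_pos, hx_zero⟩ := (hpos.and ((eLpNorm_eq_zero_iff hf hq).1 h)).exists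
  exact hx_pos.ne' hx_zero

lemma eLpNorm_one_rpow_le {p : ℝ} (hp : 1 ≤ p) {f : α → V} (hf : AEStronglyMeasurable f μ) :
    eLpNorm f 1 μ ^ p ≤ eLpNorm f (ENNReal.ofReal p) μ ^ p * μ Set.univ ^ (p - 1) := by
  have hp0 : 0 < p := one_pos.trans_le hp
  have hholder := eLpNorm_le_eLpNorm_mul_rpow_measure_univ (p := 1) (q := ENNReal.ofReal p)
    (by simpa using hp) hf
  have hexp : (1 / 1 - 1 / p) * p = p - 1 := by field_simp
  simpa only [ENNReal.mul_rpow_of_nonneg _ _ hp0.le, ← ENNReal.rpow_mul, ENNReal.toReal_one,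
    ENNReal.toReal_ofReal hp0.le, hexp] using ENNReal.rpow_le_rpow hholder hp0.le

lemma tendsto_eLpNorm_prodMk_sub (hq : 1 ≤ q) {f : ℕ → α → V} {g : ℕ → α → W} {F : α → V}
    {G : α → W} (hf : ∀ n, AEStronglyMeasurable (f n - F) μ)
    (hg : ∀ n, AEStronglyMeasurable (g n - G) μ)
    (hfF : Tendsto (fun n => eLpNorm (f n - F) q μ) atTop (𝓝 0))
    (hgG : Tendsto (fun n => eLpNorm (g n - G) q μ) atTop (𝓝 0)) :
    Tendsto (fun n => eLpNorm ((fun x => (f n x, g n x)) - fun x => (F x, G x)) q μ) atTop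
      (𝓝 0) := by
  have hsum := hfF.add hgG
  rw [add_zero] at hsum
  refine tendsto_of_tendsto_of_tendsto_of_le_of_le tendsto_const_nhds hsum (fun _ => zero_le)
    fun n => ?_
  calc eLpNorm ((fun x => (f n x, g n x)) - fun x => (F x, G x)) q μ
      ≤ eLpNorm ((fun x => ‖(f n - F) x‖) + fun x => ‖(g n - G) x‖) q μ := by
        refine eLpNorm_mono_real fun x => ?_
        exact max_le_add_of_nonneg (norm_nonneg _) (norm_nonneg _)
    _ ≤ eLpNorm (f n - F) q μ + eLpNorm (g n - G) q μ := by
        simpa only [eLpNorm_norm] using eLpNorm_add_le (hf n).norm (hg n).norm hq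

-- The majorants inherit uniform integrability and tightness from their convergence in `L^q`
-- and pass both on to `f`, so that Vitali's theorem applies.
lemma tendsto_eLpNorm_of_norm_le_mul [NormedSpace ℝ W] (hq : 1 ≤ q) (hq_top : q ≠ ⊤)
    {f : ℕ → α → V} {F : α → V} {g : ℕ → α → W} {G : α → W} {K : NNReal}
    (hf : ∀ n, AEStronglyMeasurable (f n) μ) (hF : MemLp F q μ) (hg : ∀ n, MemLp (g n) q μ)
    (hG : MemLp G q μ) (hfg : ∀ n x, ‖f n x‖ ≤ K * ‖g n x‖)
    (hlim : ∀ᵐ x ∂μ, Tendsto (fun n => f n x) atTop (𝓝 (F x)))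
    (hgG : Tendsto (fun n => eLpNorm (g n - G) q μ) atTop (𝓝 0)) :
    Tendsto (fun n => eLpNorm (f n - F) q μ) atTop (𝓝 0) := by
  have hKgG : Tendsto (fun n => eLpNorm ((K : ℝ) • g n - (K : ℝ) • G) q μ) atTop (𝓝 0) := by
    simp only [← smul_sub, eLpNorm_const_smul]
    simpa using ENNReal.Tendsto.const_mul hgG (Or.inr (enorm_ne_top (x := (K : ℝ))))
  obtain ⟨-, hunif_integ, hunif_tight⟩ := (tendstoInMeasure_iff_tendsto_Lp hq hq_top
    (fun n => (hg n).const_smul (K : ℝ)) (hG.const_smul (K : ℝ))).2 hKgG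
  have hindicator : ∀ (t : Set α) (n : ℕ),
      eLpNorm (t.indicator (f n)) q μ ≤ eLpNorm (t.indicator ((K : ℝ) • g n)) q μ := by
    refine fun t n => eLpNorm_mono fun x => ?_
    rw [norm_indicator_eq_indicator_norm, norm_indicator_eq_indicator_norm]
    exact Set.indicator_le_indicator (by simpa [norm_smul] using hfg n x)
  refine tendsto_Lp_of_tendsto_ae hq hq_top hf hF (fun ε hε => ?_) (fun ε hε => ?_) hlim
  · obtain ⟨δ, hδ, h⟩ := hunif_integ hε
    exact ⟨δ, hδ, fun n t ht hμ => (hindicator t n).trans (h n t ht hμ)⟩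
  · obtain ⟨t, ht, h⟩ := hunif_tight hε
    exact ⟨t, ht, fun n => (hindicator tᶜ n).trans (h n)⟩

lemma tendsto_eLpNorm_of_norm_le_mul_prodMk {W₁ W₂ : Type*} [NormedAddCommGroup W₁]
    [NormedSpace ℝ W₁] [NormedAddCommGroup W₂] [NormedSpace ℝ W₂] (hq : 1 ≤ q) (hq_top : q ≠ ⊤)
    {f : ℕ → α → V} {F : α → V} {g : ℕ → α → W₁} {G : α → W₁} {h : ℕ → α → W₂} {H : α → W₂}
    {K : NNReal} (hf : ∀ n, AEStronglyMeasurable (f n) μ) (hF : MemLp F q μ)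
    (hg : ∀ n, MemLp (g n) q μ) (hG : MemLp G q μ) (hh : ∀ n, MemLp (h n) q μ) (hH : MemLp H q μ)
    (hfgh : ∀ n x, ‖f n x‖ ≤ K * ‖(g n x, h n x)‖)
    (hlim : ∀ᵐ x ∂μ, Tendsto (fun n => f n x) atTop (𝓝 (F x)))
    (hgG : Tendsto (fun n => eLpNorm (g n - G) q μ) atTop (𝓝 0))
    (hhH : Tendsto (fun n => eLpNorm (h n - H) q μ) atTop (𝓝 0)) :
    Tendsto (fun n => eLpNorm (f n - F) q μ) atTop (𝓝 0) :=
  tendsto_eLpNorm_of_norm_le_mul hq hq_top hf hF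
    (fun n => MemLp.of_fst_snd ⟨hg n, hh n⟩) (MemLp.of_fst_snd ⟨hG, hH⟩) hfgh hlim
    (tendsto_eLpNorm_prodMk_sub hq (fun n => (hg n).1.sub hG.1) (fun n => (hh n).1.sub hH.1)
      hgG hhH)

end Lq

/-! ### Integrability of the kernel -/

section Kernel

variable {V : Type*} [NormedAddCommGroup V] [MeasurableSpace V] {μ : Measure V}

lemma lintegral_comp_sub_prod_right [MeasurableAdd₂ V] [MeasurableNeg V] [SFinite μ]
    [μ.IsAddLeftInvariant] [μ.IsNegInvariant] (ν : Measure V) [SFinite ν] {G : V → ENNReal}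
    (hG : Measurable G) :
    ∫⁻ z, G (z.1 - z.2) ∂(ν.prod μ) = ν Set.univ * ∫⁻ h, G h ∂μ := by
  have : MeasurableSub₂ V := inferInstance
  rw [lintegral_prod _ (by fun_prop)]
  simp only [lintegral_sub_left_eq_self G, lintegral_const, mul_comm]

lemma lintegral_comp_sub_prod_left [MeasurableAdd₂ V] [MeasurableNeg V] [SFinite μ]
    [μ.IsAddRightInvariant] (ν : Measure V) [SFinite ν] {G : V → ENNReal}
    (hG : Measurable G) :
    ∫⁻ z, G (z.1 - z.2) ∂(μ.prod ν) = ν Set.univ * ∫⁻ h, G h ∂μ := by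
  rw [lintegral_prod_symm _ (by fun_prop)]
  simp only [lintegral_sub_right_eq_self G, lintegral_const, mul_comm]

variable [NormedSpace ℝ V] [FiniteDimensional ℝ V] [BorelSpace V] [μ.IsAddHaarMeasure]

open Module

lemma integrableOn_ball_norm_rpow_div_norm_rpow [Nontrivial V] {p r : ℝ} (hp : 0 < p)
    (hrp : r < p) :
    IntegrableOn (fun h : V => ‖h‖ ^ p / ‖h‖ ^ (finrank ℝ V + r)) (Metric.ball 0 1) μ := by
  refine integrableOn_ball_of_norm_le_rpow (C := 1) (α := finrank ℝ V + r - p) finrank_pos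
    (by linarith) (.of_forall fun h => ?_) (Measurable.aestronglyMeasurable (by fun_prop))
  rw [Real.norm_of_nonneg (by positivity), one_mul, neg_sub]
  rcases eq_or_ne h 0 with rfl | h0
  · simp [Real.zero_rpow hp.ne', Real.zero_rpow_nonneg]
  · rw [Real.rpow_sub (norm_pos_iff.2 h0)]

lemma integrableOn_compl_ball_inv_norm_rpow {r : ℝ} (hr : 0 < r) :
    IntegrableOn (fun h : V => (‖h‖ ^ (finrank ℝ V + r))⁻¹) (Metric.ball 0 1)ᶜ μ := by
  have hdecay := (integrable_one_add_norm (E := V) (μ := μ) (r := finrank ℝ V + r)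
    (by linarith)).const_mul (2 ^ (finrank ℝ V + r))
  refine hdecay.integrableOn.mono' (Measurable.aestronglyMeasurable (by fun_prop)) ?_
  refine (ae_restrict_iff' measurableSet_ball.compl).2 (.of_forall fun h hh => ?_)
  have hh : 1 ≤ ‖h‖ := by simpa using hh
  rw [Real.norm_of_nonneg (by positivity), Real.rpow_neg (by positivity), ← div_eq_mul_inv,
    inv_eq_one_div, div_le_div_iff₀ (by positivity) (by positivity), one_mul,
    ← Real.mul_rpow zero_le_two (norm_nonneg h)]
  gcongr
  linarith

lemma lintegral_min_rpow_div_norm_rpow_lt_top [Nontrivial V] {p r L M : ℝ} (hr : 0 < r)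
    (hrp : r < p) (hL : 0 ≤ L) (hM : 0 ≤ M) :
    ∫⁻ h : V, ENNReal.ofReal (min (L * ‖h‖) M ^ p / ‖h‖ ^ (finrank ℝ V + r)) ∂μ < ⊤ := by
  have hp : 0 < p := hr.trans hrp
  have hnear := ((integrableOn_ball_norm_rpow_div_norm_rpow (V := V) (μ := μ) hp hrp).const_mul
    (L ^ p)).lintegral_lt_top
  have hfar := ((integrableOn_compl_ball_inv_norm_rpow (V := V) (μ := μ) hr).const_mul
    (M ^ p)).lintegral_lt_top
  rw [← lintegral_add_compl _ (measurableSet_ball (x := (0 : V)) (ε := 1))]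
  refine ENNReal.add_lt_top.2 ⟨(lintegral_mono fun h => ENNReal.ofReal_le_ofReal ?_).trans_lt hnear,
    (lintegral_mono fun h => ENNReal.ofReal_le_ofReal ?_).trans_lt hfar⟩
  · rw [← mul_div_assoc, ← Real.mul_rpow hL (norm_nonneg h)]
    gcongr
    exact min_le_left _ _
  · rw [div_eq_mul_inv]
    gcongr
    exact min_le_right _ _

end Kernel

/-! ### The Gagliardo seminorm as an `L^p` norm -/

section Gagliardo

variable {N : ℕ} {s p : ℝ}

/-- The increment `u(x) - u(y)` as a function of the pair `(x, y)`. -/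
def increment {α V : Type*} [Sub V] (u : α → V) (z : α × α) : V := u z.1 - u z.2

/-- The measure `|x - y|^{-(N+sp)} dx dy` on `ℝ^N × ℝ^N`, for which the Gagliardo seminorm of `u`
is the `L^p` norm of `increment u`. The density is a real inverse, hence `0` on the diagonal. -/
def gagliardoMeasure (N : ℕ) (s p : ℝ) : Measure (E N × E N) :=
  ((volume : Measure (E N)).prod volume).withDensity fun z =>
    ENNReal.ofReal (‖z.1 - z.2‖ ^ ((N : ℝ) + s * p))⁻¹

lemma gagliardoMeasure_absolutelyContinuous :
    gagliardoMeasure N s p ≪ (volume : Measure (E N)).prod volume :=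
  withDensity_absolutelyContinuous _ _

lemma ae_prod_of_ae_gagliardoMeasure {P : E N × E N → Prop} (hdiag : ∀ x, P (x, x))
    (h : ∀ᵐ z ∂gagliardoMeasure N s p, P z) :
    ∀ᵐ z ∂((volume : Measure (E N)).prod volume), P z := by
  rw [gagliardoMeasure, ae_withDensity_iff (by fun_prop)] at h
  filter_upwards [h] with z hz
  rcases eq_or_ne z.1 z.2 with hz' | hz'
  · rw [show z = (z.1, z.1) from Prod.ext rfl hz'.symm]
    exact hdiag z.1
  · have : 0 < ‖z.1 - z.2‖ := norm_pos_iff.2 (sub_ne_zero.2 hz')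
    exact hz (ENNReal.ofReal_pos.2 (by positivity)).ne'

lemma gagliardoPow_eq_lintegral (hp : 0 ≤ p) (u : E N → ℝ) :
    gagliardoPow s p u = ∫⁻ z, ‖increment u z‖ₑ ^ p ∂gagliardoMeasure N s p := by
  rw [gagliardoMeasure, lintegral_withDensity_eq_lintegral_mul_non_measurable _ (by fun_prop)
    (.of_forall fun _ => ENNReal.ofReal_lt_top)]
  refine lintegral_congr fun z => ?_
  rw [Pi.mul_apply, ← ofReal_norm, ENNReal.ofReal_rpow_of_nonneg (norm_nonneg _) hp,
    ← ENNReal.ofReal_mul (by positivity), inv_mul_eq_div]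
  rfl

lemma gagliardoPow_eq_eLpNorm_rpow (hp : 0 < p) (u : E N → ℝ) :
    gagliardoPow s p u =
      eLpNorm (increment u) (ENNReal.ofReal p) (gagliardoMeasure N s p) ^ p := by
  rw [gagliardoPow_eq_lintegral hp.le, eLpNorm_ofReal_rpow hp]

lemma gagliardo_eq_eLpNorm (hp : 0 < p) (u : E N → ℝ) :
    gagliardo s p u = eLpNorm (increment u) (ENNReal.ofReal p) (gagliardoMeasure N s p) := by
  rw [gagliardo, gagliardoPow_eq_eLpNorm_rpow hp, ← ENNReal.rpow_mul, mul_one_div_cancel hp.ne',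
    ENNReal.rpow_one]

lemma gagliardoPow_eq_ofReal_integral (hp : 0 < p) {u : E N → ℝ}
    (hu : MemLp (increment u) (ENNReal.ofReal p) (gagliardoMeasure N s p)) :
    gagliardoPow s p u =
      ENNReal.ofReal (∫ z, |increment u z| ^ p ∂gagliardoMeasure N s p) := by
  rw [gagliardoPow_eq_lintegral hp.le, ofReal_integral_eq_lintegral_ofReal
    (integrable_abs_rpow hp hu) (.of_forall fun z => by positivity)]
  refine lintegral_congr fun z => ?_
  rw [← ofReal_norm, ENNReal.ofReal_rpow_of_nonneg (norm_nonneg _) hp.le, Real.norm_eq_abs]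

lemma gagliardoPow_const_mul (hp : 0 < p) (c : ℝ) (u : E N → ℝ) :
    gagliardoPow s p (fun x => c * u x) = ‖c‖ₑ ^ p * gagliardoPow s p u := by
  have hincr : increment (fun x => c * u x) = c • increment u := by
    ext z
    simp [increment, mul_sub]
  rw [gagliardoPow_eq_eLpNorm_rpow hp, gagliardoPow_eq_eLpNorm_rpow hp, hincr,
    eLpNorm_const_smul, ENNReal.mul_rpow_of_nonneg _ _ hp.le]

lemma fracPairing_eq_integral (u v : E N → ℝ) :
    fracPairing s p u v =
      ∫ z, signedPow p (increment u z) * increment v z ∂gagliardoMeasure N s p := by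
  rw [gagliardoMeasure, integral_withDensity_eq_integral_toReal_smul (by fun_prop)
    (.of_forall fun _ => ENNReal.ofReal_lt_top)]
  refine integral_congr_ae (.of_forall fun z => ?_)
  simp only [ENNReal.toReal_ofReal (inv_nonneg.2 (Real.rpow_nonneg (norm_nonneg _) _)),
    smul_eq_mul, inv_mul_eq_div]
  rfl

lemma fracPairing_const_mul_left (hp : p ≠ 1) {c : ℝ} (hc : 0 ≤ c) (u v : E N → ℝ) :
    fracPairing s p (fun x => c * u x) v = c ^ (p - 1) * fracPairing s p u v := by
  simp only [fracPairing_eq_integral, increment, ← mul_sub, signedPow_mul hp hc, mul_assoc,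
    integral_const_mul]

lemma gagliardoPow_eq_ofReal_fracPairing_self (hp : 0 < p) {u : E N → ℝ}
    (hu : MemLp (increment u) (ENNReal.ofReal p) (gagliardoMeasure N s p)) :
    gagliardoPow s p u = ENNReal.ofReal (fracPairing s p u u) := by
  simp only [gagliardoPow_eq_ofReal_integral hp hu, fracPairing_eq_integral,
    signedPow_mul_self hp.ne']

lemma aestronglyMeasurable_increment {V : Type*} [NormedAddCommGroup V] {u : E N → V}
    (hu : AEStronglyMeasurable u volume) :
    AEStronglyMeasurable (increment u) (gagliardoMeasure N s p) :=
  (hu.comp_fst.sub hu.comp_snd).mono_ac gagliardoMeasure_absolutelyContinuous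

lemma memLp_increment_comp_lipschitzWith {V W : Type*} [NormedAddCommGroup V]
    [NormedAddCommGroup W] {q : ENNReal} {K : NNReal} {F : V × W → ℝ} (hF : LipschitzWith K F)
    {u : E N → V} {v : E N → W} (hu : AEStronglyMeasurable u volume)
    (hv : AEStronglyMeasurable v volume) (hu_incr : MemLp (increment u) q (gagliardoMeasure N s p))
    (hv_incr : MemLp (increment v) q (gagliardoMeasure N s p)) :
    MemLp (increment fun x => F (u x, v x)) q (gagliardoMeasure N s p) :=
  (MemLp.of_fst_snd (f := fun z => (increment u z, increment v z)) ⟨hu_incr, hv_incr⟩).of_le_mul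
    (aestronglyMeasurable_increment
      (hF.continuous.comp_aestronglyMeasurable (hu.prodMk hv)))
    (.of_forall fun _ => hF.norm_sub_le _ _)

lemma ae_gagliardoMeasure_of_ae {P : E N → Prop} (h : ∀ᵐ x, P x) :
    ∀ᵐ z ∂gagliardoMeasure N s p, P z.1 ∧ P z.2 :=
  gagliardoMeasure_absolutelyContinuous.ae_le
    ((Measure.quasiMeasurePreserving_fst.ae h).and (Measure.quasiMeasurePreserving_snd.ae h))

lemma gagliardoPow_lt_top_of_lipschitzWith [NeZero N] (hs : s ∈ Set.Ioo 0 1) (hp : 0 < p)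
    {u : E N → ℝ} {K : NNReal} (hu : LipschitzWith K u) {M : ℝ} (hM : ∀ x, |u x| ≤ M)
    {S : Set (E N)} (hS : volume S < ⊤) (hSu : ∀ x ∉ S, u x = 0) : gagliardoPow s p u < ⊤ := by
  set G : E N → ENNReal := fun h =>
    ENNReal.ofReal (min (K * ‖h‖) (M + M) ^ p / ‖h‖ ^ ((N : ℝ) + s * p))
  have hG : Measurable G := by fun_prop
  have hM0 : 0 ≤ M := (abs_nonneg _).trans (hM 0)
  have hG_fin : ∫⁻ h, G h < ⊤ := by
    simpa using lintegral_min_rpow_div_norm_rpow_lt_top (V := E N) (μ := volume)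
      (mul_pos hs.1 hp) (mul_lt_of_lt_one_left hp hs.2) K.2 (add_nonneg hM0 hM0)
  have hle : ∀ z : E N × E N, ENNReal.ofReal (|u z.1 - u z.2| ^ p / ‖z.1 - z.2‖ ^ (N + s * p)) ≤
      (S ×ˢ Set.univ ∪ Set.univ ×ˢ S).indicator (fun z => G (z.1 - z.2)) z := by
    intro z
    by_cases hz : z ∈ S ×ˢ Set.univ ∪ Set.univ ×ˢ S
    · rw [Set.indicator_of_mem hz]
      refine ENNReal.ofReal_le_ofReal (div_le_div_of_nonneg_right (Real.rpow_le_rpow (abs_nonneg _)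
        (le_min ?_ ?_) hp.le) (by positivity))
      · simpa [Real.dist_eq, dist_eq_norm] using hu.dist_le_mul z.1 z.2
      · exact (abs_sub _ _).trans (add_le_add (hM _) (hM _))
    · obtain ⟨h1, h2⟩ : z.1 ∉ S ∧ z.2 ∉ S := by simpa [not_or] using hz
      simp [hSu _ h1, hSu _ h2, Real.zero_rpow hp.ne']
  calc gagliardoPow s p u
      ≤ ∫⁻ z in S ×ˢ Set.univ ∪ Set.univ ×ˢ S, G (z.1 - z.2) ∂(volume.prod volume) :=
        (lintegral_mono hle).trans (lintegral_indicator_le _ _)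
    _ ≤ volume S * (∫⁻ h, G h) + volume S * ∫⁻ h, G h := by
        refine (lintegral_union_le _ _ _).trans_eq ?_
        simp only [← Measure.prod_restrict, Measure.restrict_univ]
        rw [lintegral_comp_sub_prod_right _ hG, lintegral_comp_sub_prod_left _ hG,
          Measure.restrict_apply_univ]
    _ < ⊤ := ENNReal.add_lt_top.2 ⟨ENNReal.mul_lt_top hS hG_fin, ENNReal.mul_lt_top hS hG_fin⟩

end Gagliardo

/-! ### The space `W_0^{s,p}` -/

section W0

variable {N : ℕ} {s p : ℝ} {Ω : Set (E N)} {u v ψ : E N → ℝ}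

lemma increment_sub (u v : E N → ℝ) :
    increment (fun x => u x - v x) = increment u - increment v := by
  ext z
  simp only [increment, Pi.sub_apply]
  ring

lemma sobolevNorm_sub_eq_add_eLpNorm (hp : 0 < p) (u v : E N → ℝ) :
    sobolevNorm s p (fun x => u x - v x) =
      eLpNorm (increment u - increment v) (ENNReal.ofReal p) (gagliardoMeasure N s p) +
        eLpNorm (u - v) (ENNReal.ofReal p) volume := by
  rw [sobolevNorm, gagliardo_eq_eLpNorm hp, increment_sub]
  rfl

namespace IsTestFunction

lemma aestronglyMeasurable (hψ : IsTestFunction Ω ψ) : AEStronglyMeasurable ψ volume :=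
  hψ.contDiff.continuous.aestronglyMeasurable

lemma memLp (hψ : IsTestFunction Ω ψ) (q : ENNReal) : MemLp ψ q volume :=
  hψ.contDiff.continuous.memLp_of_hasCompactSupport hψ.hasCompactSupport

lemma gagliardoPow_lt_top [NeZero N] (hs : s ∈ Set.Ioo (0 : ℝ) 1) (hp : 0 < p)
    (hψ : IsTestFunction Ω ψ) : gagliardoPow s p ψ < ⊤ := by
  obtain ⟨K, hK⟩ := (hψ.contDiff.of_le (by simp)).lipschitzWith_of_hasCompactSupport
    hψ.hasCompactSupport one_ne_zero
  obtain ⟨M, hM⟩ := hψ.hasCompactSupport.exists_bound_of_continuous hψ.contDiff.continuous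
  exact gagliardoPow_lt_top_of_lipschitzWith hs hp hK hM
    hψ.hasCompactSupport.isCompact.measure_lt_top fun _ => image_eq_zero_of_notMem_tsupport

lemma memLp_increment [NeZero N] (hs : s ∈ Set.Ioo (0 : ℝ) 1) (hp : 0 < p)
    (hψ : IsTestFunction Ω ψ) :
    MemLp (increment ψ) (ENNReal.ofReal p) (gagliardoMeasure N s p) := by
  refine ⟨aestronglyMeasurable_increment hψ.aestronglyMeasurable, ?_⟩
  rw [← gagliardo_eq_eLpNorm hp]
  exact ENNReal.rpow_lt_top_of_nonneg (by positivity) (hψ.gagliardoPow_lt_top hs hp).ne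

lemma memW0 (hp : 0 < p) (hψ : IsTestFunction Ω ψ) : MemW0 s p Ω ψ := by
  refine ⟨hψ.aestronglyMeasurable, fun ε hε => ⟨ψ, hψ, ?_⟩⟩
  rw [sobolevNorm_sub_eq_add_eLpNorm hp]
  simpa using hε

lemma comp {F : ℝ × ℝ → ℝ} (hF : ContDiff ℝ ∞ F) (hF0 : F 0 = 0)
    (hu : IsTestFunction Ω u) (hv : IsTestFunction Ω v) :
    IsTestFunction Ω fun x => F (u x, v x) := by
  have hsub : tsupport (fun x => F (u x, v x)) ⊆ tsupport u ∪ tsupport v := by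
    refine closure_minimal (fun x hx => ?_) ((isClosed_tsupport _).union (isClosed_tsupport _))
    contrapose! hx
    obtain ⟨hxu, hxv⟩ := not_or.1 hx
    rw [Function.notMem_support, image_eq_zero_of_notMem_tsupport hxu,
      image_eq_zero_of_notMem_tsupport hxv]
    exact hF0
  refine ⟨hF.comp (hu.contDiff.prodMk hv.contDiff), ?_,
    hsub.trans (Set.union_subset hu.tsupport_subset hv.tsupport_subset)⟩
  exact (hu.hasCompactSupport.isCompact.union hv.hasCompactSupport.isCompact).of_isClosed_subset
    (isClosed_tsupport _) hsub

end IsTestFunction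

namespace MemW0

lemma of_tendsto (hp : 0 < p) {ψ : ℕ → E N → ℝ} (hu : AEStronglyMeasurable u volume)
    (hψ : ∀ n, IsTestFunction Ω (ψ n))
    (hlim : Tendsto (fun n => eLpNorm (ψ n - u) (ENNReal.ofReal p) volume) atTop (𝓝 0))
    (hlim_incr : Tendsto (fun n => eLpNorm (increment (ψ n) - increment u) (ENNReal.ofReal p)
      (gagliardoMeasure N s p)) atTop (𝓝 0)) : MemW0 s p Ω u := by
  refine ⟨hu, fun ε hε => ?_⟩
  have hsum := hlim_incr.add hlim
  rw [add_zero] at hsum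
  obtain ⟨n, hn⟩ := (hsum.eventually_lt_const hε).exists
  refine ⟨ψ n, hψ n, ?_⟩
  rwa [sobolevNorm_sub_eq_add_eLpNorm hp, eLpNorm_sub_comm, eLpNorm_sub_comm u]

lemma exists_seq (hp : 0 < p) (hu : MemW0 s p Ω u) :
    ∃ ψ : ℕ → E N → ℝ, (∀ n, IsTestFunction Ω (ψ n)) ∧
      Tendsto (fun n => eLpNorm (ψ n - u) (ENNReal.ofReal p) volume) atTop (𝓝 0) ∧
      Tendsto (fun n => eLpNorm (increment (ψ n) - increment u) (ENNReal.ofReal p)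
        (gagliardoMeasure N s p)) atTop (𝓝 0) ∧
      ∀ᵐ x, Tendsto (fun n => ψ n x) atTop (𝓝 (u x)) := by
  choose ψ hψ hlt using fun n : ℕ => hu.mem_closure ((n : ENNReal) + 1)⁻¹ (by simp)
  have hzero : Tendsto (fun n : ℕ => ((n : ENNReal) + 1)⁻¹) atTop (𝓝 0) := by
    simpa using (tendsto_add_atTop_iff_nat 1).2 ENNReal.tendsto_inv_nat_nhds_zero
  have hle : ∀ n, eLpNorm (increment (ψ n) - increment u) (ENNReal.ofReal p)
      (gagliardoMeasure N s p) + eLpNorm (ψ n - u) (ENNReal.ofReal p) volume ≤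
        ((n : ENNReal) + 1)⁻¹ := fun n => by
    rw [eLpNorm_sub_comm, eLpNorm_sub_comm (ψ n), ← sobolevNorm_sub_eq_add_eLpNorm hp]
    exact (hlt n).le
  have hlim : Tendsto (fun n => eLpNorm (ψ n - u) (ENNReal.ofReal p) volume) atTop (𝓝 0) :=
    tendsto_of_tendsto_of_tendsto_of_le_of_le tendsto_const_nhds hzero (fun _ => zero_le)
      fun n => le_add_self.trans (hle n)
  have hlim_incr : Tendsto (fun n => eLpNorm (increment (ψ n) - increment u) (ENNReal.ofReal p)
      (gagliardoMeasure N s p)) atTop (𝓝 0) :=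
    tendsto_of_tendsto_of_tendsto_of_le_of_le tendsto_const_nhds hzero (fun _ => zero_le)
      fun n => le_self_add.trans (hle n)
  obtain ⟨ns, hns, hae⟩ := (tendstoInMeasure_of_tendsto_eLpNorm (by simpa using hp)
    (fun n => (hψ n).aestronglyMeasurable) hu.aestronglyMeasurable hlim).exists_seq_tendsto_ae
  exact ⟨ψ ∘ ns, fun n => hψ _, hlim.comp hns.tendsto_atTop, hlim_incr.comp hns.tendsto_atTop, hae⟩

lemma memLp (hp : 0 < p) (hu : MemW0 s p Ω u) : MemLp u (ENNReal.ofReal p) volume := by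
  obtain ⟨ψ, hψ, hlt⟩ := hu.mem_closure 1 one_pos
  rw [sobolevNorm_sub_eq_add_eLpNorm hp] at hlt
  have hsub : MemLp (u - ψ) (ENNReal.ofReal p) volume :=
    ⟨hu.aestronglyMeasurable.sub hψ.aestronglyMeasurable,
      le_add_self.trans_lt (hlt.trans ENNReal.one_lt_top)⟩
  simpa using hsub.add (hψ.memLp _)

lemma memLp_increment [NeZero N] (hs : s ∈ Set.Ioo (0 : ℝ) 1) (hp : 0 < p)
    (hu : MemW0 s p Ω u) :
    MemLp (increment u) (ENNReal.ofReal p) (gagliardoMeasure N s p) := by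
  obtain ⟨ψ, hψ, hlt⟩ := hu.mem_closure 1 one_pos
  rw [sobolevNorm_sub_eq_add_eLpNorm hp] at hlt
  have hsub : MemLp (increment u - increment ψ) (ENNReal.ofReal p) (gagliardoMeasure N s p) :=
    ⟨(aestronglyMeasurable_increment hu.aestronglyMeasurable).sub
      (aestronglyMeasurable_increment hψ.aestronglyMeasurable),
      le_self_add.trans_lt (hlt.trans ENNReal.one_lt_top)⟩
  simpa using hsub.add (hψ.memLp_increment hs hp)

lemma integrableOn (hp : 1 ≤ p) (hΩ : volume Ω < ⊤) (hu : MemW0 s p Ω u) :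
    IntegrableOn u Ω := by
  have : IsFiniteMeasure (volume.restrict Ω) := ⟨by simpa using hΩ⟩
  exact ((hu.memLp (one_pos.trans_le hp)).restrict Ω).integrable (by simpa using hp)

lemma comp_lipschitzWith [NeZero N] (hs : s ∈ Set.Ioo (0 : ℝ) 1) (hp : 1 ≤ p) {K : NNReal}
    {F : ℝ × ℝ → ℝ} (hF : LipschitzWith K F) (hF0 : F 0 = 0) (hu : MemW0 s p Ω u)
    (hv : MemW0 s p Ω v) : MemW0 s p Ω fun x => F (u x, v x) := by
  have hp0 : 0 < p := one_pos.trans_le hp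
  have hq : 1 ≤ ENNReal.ofReal p := by simpa using hp
  obtain ⟨α, hα, hαu, hαu_incr, hαu_ae⟩ := hu.exists_seq hp0
  obtain ⟨β, hβ, hβv, hβv_incr, hβv_ae⟩ := hv.exists_seq hp0
  obtain ⟨H, hH, hH_lip, hH0, hHF⟩ :=
    exists_seq_contDiff_lipschitzWith_tendstoUniformly_of_map_zero hF hF0
  have hψ : ∀ n, IsTestFunction Ω fun x => H n (α n x, β n x) := fun n =>
    (hα n).comp (hH n) (hH0 n) (hβ n)
  have hmeas : AEStronglyMeasurable (fun x => F (u x, v x)) volume :=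
    hF.continuous.comp_aestronglyMeasurable (hu.aestronglyMeasurable.prodMk hv.aestronglyMeasurable)
  have hlim : ∀ᵐ x, Tendsto (fun n => H n (α n x, β n x)) atTop (𝓝 (F (u x, v x))) := by
    filter_upwards [hαu_ae, hβv_ae] with x hx hy
    exact hHF.tendsto_comp hF.continuous.continuousAt (hx.prodMk_nhds hy)
  have hlim_incr : ∀ᵐ z ∂gagliardoMeasure N s p,
      Tendsto (fun n => increment (fun x => H n (α n x, β n x)) z) atTop
        (𝓝 (increment (fun x => F (u x, v x)) z)) :=
    (ae_gagliardoMeasure_of_ae hlim).mono fun z hz => hz.1.sub hz.2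
  have hF_memLp : MemLp (fun x => F (u x, v x)) (ENNReal.ofReal p) volume :=
    hF.comp_memLp hF0 (MemLp.of_fst_snd ⟨hu.memLp hp0, hv.memLp hp0⟩)
  have hF_memLp_incr := memLp_increment_comp_lipschitzWith hF hu.aestronglyMeasurable
    hv.aestronglyMeasurable (hu.memLp_increment hs hp0) (hv.memLp_increment hs hp0)
  refine of_tendsto hp0 hmeas hψ ?_ ?_
  · exact tendsto_eLpNorm_of_norm_le_mul_prodMk hq ENNReal.ofReal_ne_top
      (fun n => (hψ n).aestronglyMeasurable) hF_memLp (fun n => (hα n).memLp _) (hu.memLp hp0)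
      (fun n => (hβ n).memLp _) (hv.memLp hp0) (fun n x => (hH_lip n).norm_le_mul (hH0 n) _) hlim
      hαu hβv
  · exact tendsto_eLpNorm_of_norm_le_mul_prodMk hq ENNReal.ofReal_ne_top
      (fun n => aestronglyMeasurable_increment (hψ n).aestronglyMeasurable) hF_memLp_incr
      (fun n => (hα n).memLp_increment hs hp0) (hu.memLp_increment hs hp0)
      (fun n => (hβ n).memLp_increment hs hp0) (hv.memLp_increment hs hp0)
      (fun n z => (hH_lip n).norm_sub_le _ _) hlim_incr hαu_incr hβv_incr

lemma posPart_sub [NeZero N] (hs : s ∈ Set.Ioo (0 : ℝ) 1) (hp : 1 ≤ p) (hu : MemW0 s p Ω u)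
    (hv : MemW0 s p Ω v) : MemW0 s p Ω fun x => max (u x - v x) 0 :=
  comp_lipschitzWith (F := fun a => max (a.1 - a.2) 0) hs hp
    ((LipschitzWith.prod_fst.sub LipschitzWith.prod_snd).max_const 0) (by simp) hu hv

lemma const_mul [NeZero N] (hs : s ∈ Set.Ioo (0 : ℝ) 1) (hp : 1 ≤ p) (hu : MemW0 s p Ω u)
    (c : ℝ) : MemW0 s p Ω fun x => c * u x :=
  comp_lipschitzWith (F := fun a => c * a.1) hs hp
    ((lipschitzWith_smul c).comp LipschitzWith.prod_fst) (by simp) hu hu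

lemma zero (hp : 0 < p) : MemW0 s p Ω fun _ => 0 :=
  IsTestFunction.memW0 hp
    ⟨contDiff_const, HasCompactSupport.zero, by simp [tsupport]⟩

end MemW0

end W0

/-! ### The comparison principle -/

section Comparison

variable {N : ℕ} [NeZero N] {s p : ℝ} {Ω : Set (E N)} {u v : E N → ℝ}

lemma ae_eq_zero_of_ae_prod_eq {α V : Type*} [MeasurableSpace α] [NormedAddCommGroup V]
    {μ : Measure α} [SFinite μ] (hμ : μ Set.univ = ⊤) {q : ENNReal} (hq0 : q ≠ 0) (hq_top : q ≠ ⊤)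
    {w : α → V} (hw : MemLp w q μ) (h : ∀ᵐ z ∂μ.prod μ, w z.1 = w z.2) : w =ᵐ[μ] 0 := by
  have : NeZero μ := ⟨fun h => by simp [h] at hμ⟩
  obtain ⟨x, hx⟩ := (Measure.ae_ae_of_ae_prod h).exists
  have hconst : w =ᵐ[μ] fun _ => w x := hx.mono fun y hy => hy.symm
  have hmem := (memLp_congr_ae hconst).1 hw
  rw [memLp_const_iff hq0 hq_top, hμ] at hmem
  have hwx : w x = 0 := by simpa using hmem
  rwa [hwx] at hconst

theorem ae_le_of_fracPairing_le (hs : s ∈ Set.Ioo (0 : ℝ) 1) (hp : 1 < p)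
    (hu : MemW0 s p Ω u) (hv : MemW0 s p Ω v)
    (h : fracPairing s p u (fun x => max (u x - v x) 0) ≤
      fracPairing s p v (fun x => max (u x - v x) 0)) : ∀ᵐ x, u x ≤ v x := by
  have hp0 : 0 < p := one_pos.trans hp
  set w : E N → ℝ := fun x => max (u x - v x) 0
  have hw : MemW0 s p Ω w := hu.posPart_sub hs hp.le hv
  have hw_incr := hw.memLp_increment hs hp0
  have hint_u := integrable_signedPow_mul hp (hu.memLp_increment hs hp0) hw_incr
  have hint_v := integrable_signedPow_mul hp (hv.memLp_increment hs hp0) hw_incr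
  have hincr : ∀ z, increment u z - increment v z = (u z.1 - v z.1) - (u z.2 - v z.2) :=
    fun z => sub_sub_sub_comm _ _ _ _
  have hnonneg : ∀ z, 0 ≤
      (signedPow p (increment u z) - signedPow p (increment v z)) * increment w z := fun z =>
    mul_sub_nonneg_of_sub_eq_sub (strictMono_signedPow hp).monotone
      (monotone_id.max monotone_const) (hincr z)
  have hzero : ∀ᵐ z ∂gagliardoMeasure N s p,
      (signedPow p (increment u z) - signedPow p (increment v z)) * increment w z = 0 := by
    simp only [sub_mul] at hnonneg ⊢
    refine (integral_eq_zero_iff_of_nonneg hnonneg (hint_u.sub hint_v)).1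
      (le_antisymm ?_ (integral_nonneg hnonneg))
    rwa [integral_sub hint_u hint_v, sub_nonpos, ← fracPairing_eq_integral,
      ← fracPairing_eq_integral]
  have hw_const : ∀ᵐ z ∂gagliardoMeasure N s p, w z.1 = w z.2 := hzero.mono fun z hz =>
    eq_of_mul_sub_eq_zero (max · 0) (strictMono_signedPow hp).injective (hincr z) hz
  have : NoncompactSpace (E N) := NormedSpace.noncompactSpace ℝ (E N)
  have hw_zero := ae_eq_zero_of_ae_prod_eq
    (measure_univ_of_isAddLeftInvariant (volume : Measure (E N))) (by simpa using hp0)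
    ENNReal.ofReal_ne_top (hw.memLp hp0) (ae_prod_of_ae_gagliardoMeasure (fun _ => rfl) hw_const)
  exact hw_zero.mono fun x hx => sub_nonpos.1 (max_eq_right_iff.1 hx)

end Comparison

/-! ### Picone test functions -/

section Picone

variable {N : ℕ} {s p k ε : ℝ} {Ω : Set (E N)} {u v : E N → ℝ}

/-- The function `min(|a|, k)^p / (b⁺ + ε)^{p-1}` of `(a, b)`. It is the truncation of the Picone
test function `|a|^p / b^{p-1}` that is Lipschitz, hence acts on `W_0^{s,p}`. -/
def piconeFun (p k ε : ℝ) (z : ℝ × ℝ) : ℝ := min |z.1| k ^ p / (max z.2 0 + ε) ^ (p - 1)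

lemma piconeFun_nonneg (hk : 0 ≤ k) (hε : 0 ≤ ε) (z : ℝ × ℝ) : 0 ≤ piconeFun p k ε z :=
  div_nonneg (Real.rpow_nonneg (le_min (abs_nonneg _) hk) _)
    (Real.rpow_nonneg (add_nonneg (le_max_right _ _) hε) _)

lemma exists_lipschitzWith_piconeFun (hp : 1 ≤ p) (hk : 0 ≤ k) (hε : 0 < ε) :
    ∃ K, LipschitzWith K (piconeFun p k ε) := by
  have hp' : 0 ≤ p - 1 := sub_nonneg.2 hp
  obtain ⟨C, hC⟩ := exists_lipschitzWith_min_abs_rpow hp hk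
  obtain ⟨D, hD⟩ := exists_lipschitzWith_inv_max_add_rpow hp' hε
  have hnum : ∀ z : ℝ × ℝ, ‖min |z.1| k ^ p‖ ≤ k ^ p := fun z => by
    have : 0 ≤ min |z.1| k := le_min (abs_nonneg _) hk
    rw [Real.norm_of_nonneg (by positivity)]
    gcongr
    exact min_le_right _ _
  have hden : ∀ z : ℝ × ℝ, ‖((max z.2 0 + ε) ^ (p - 1))⁻¹‖ ≤ (ε ^ (p - 1))⁻¹ := fun z => by
    rw [Real.norm_of_nonneg (by positivity)]
    gcongr
    exact le_add_of_nonneg_left (le_max_right _ _)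
  have hprod : piconeFun p k ε = fun z => min |z.1| k ^ p * ((max z.2 0 + ε) ^ (p - 1))⁻¹ :=
    funext fun _ => div_eq_mul_inv _ _
  exact ⟨_, hprod ▸ lipschitzWith_mul_of_norm_le (A := ⟨k ^ p, by positivity⟩)
    (B := ⟨(ε ^ (p - 1))⁻¹, by positivity⟩) (hC.comp LipschitzWith.prod_fst)
    (hD.comp LipschitzWith.prod_snd) hnum hden⟩

lemma MemW0.comp_piconeFun [NeZero N] (hs : s ∈ Set.Ioo (0 : ℝ) 1) (hp : 1 ≤ p) (hk : 0 ≤ k)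
    (hε : 0 < ε) (hu : MemW0 s p Ω u) (hv : MemW0 s p Ω v) :
    MemW0 s p Ω fun x => piconeFun p k ε (u x, v x) := by
  obtain ⟨K, hK⟩ := exists_lipschitzWith_piconeFun hp hk hε
  refine comp_lipschitzWith hs hp hK ?_ hu hv
  simp [piconeFun, hk, Real.zero_rpow (one_pos.trans_le hp).ne']

lemma signedPow_increment_mul_increment_piconeFun_le (hp : 1 < p) (hk : 0 ≤ k) (hε : 0 < ε)
    (u : E N → ℝ) {z : E N × E N} (hz : 0 ≤ v z.1 ∧ 0 ≤ v z.2) :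
    signedPow p (increment v z) * increment (fun x => piconeFun p k ε (u x, v x)) z ≤
      |increment u z| ^ p := by
  obtain ⟨hz1, hz2⟩ := hz
  calc signedPow p (increment v z) * increment (fun x => piconeFun p k ε (u x, v x)) z
      = signedPow p ((v z.1 + ε) - (v z.2 + ε)) * (min |u z.1| k ^ p / (v z.1 + ε) ^ (p - 1) -
          min |u z.2| k ^ p / (v z.2 + ε) ^ (p - 1)) := by
        simp only [increment, piconeFun, max_eq_left hz1, max_eq_left hz2,
          add_sub_add_right_eq_sub]
    _ ≤ |min |u z.1| k - min |u z.2| k| ^ p :=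
        discrete_picone hp (by positivity) (by positivity) (le_min (abs_nonneg _) hk)
          (le_min (abs_nonneg _) hk)
    _ ≤ |increment u z| ^ p := by
        have hlip : LipschitzWith 1 fun t : ℝ => min |t| k := lipschitzWith_one_norm.min_const k
        refine Real.rpow_le_rpow (abs_nonneg _) ?_ (one_pos.trans hp).le
        simpa only [increment, Real.dist_eq, NNReal.coe_one, one_mul] using
          hlip.dist_le_mul (u z.1) (u z.2)

lemma fracPairing_piconeFun_le [NeZero N] (hs : s ∈ Set.Ioo (0 : ℝ) 1) (hp : 1 < p) (hk : 0 ≤ k)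
    (hε : 0 < ε) (hu : MemW0 s p Ω u) (hv : MemW0 s p Ω v) (hv0 : ∀ᵐ x, 0 ≤ v x) :
    ENNReal.ofReal (fracPairing s p v fun x => piconeFun p k ε (u x, v x)) ≤
      gagliardoPow s p u := by
  have hp0 : 0 < p := one_pos.trans hp
  have hu_incr := hu.memLp_increment hs hp0
  rw [gagliardoPow_eq_ofReal_integral hp0 hu_incr, fracPairing_eq_integral]
  refine ENNReal.ofReal_le_ofReal (integral_mono_ae
    (integrable_signedPow_mul hp (hv.memLp_increment hs hp0)
      ((hu.comp_piconeFun hs hp.le hk hε hv).memLp_increment hs hp0))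
    (integrable_abs_rpow hp0 hu_incr) ?_)
  exact (ae_gagliardoMeasure_of_ae hv0).mono fun z hz =>
    signedPow_increment_mul_increment_piconeFun_le hp hk hε u hz

lemma rpow_div_rpow_le_liminf_piconeFun (hp : 1 < p) (a b : ℝ) :
    ‖a‖ₑ ^ p / ENNReal.ofReal b ^ (p - 1) ≤
      liminf (fun n : ℕ => ENNReal.ofReal (piconeFun p n (1 / (n + 1)) (a, b))) atTop := by
  have hp0 : 0 < p := one_pos.trans hp
  have hp' : 0 < p - 1 := sub_pos.2 hp
  rcases eq_or_ne a 0 with rfl | ha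
  · simp [hp0]
  have hε : ∀ n : ℕ, (0 : ℝ) < 1 / (n + 1) := fun n => Nat.one_div_pos_of_nat
  have hnum : Tendsto (fun n : ℕ => ENNReal.ofReal (min |a| n)) atTop (𝓝 ‖a‖ₑ) := by
    rw [← ofReal_norm]
    refine ENNReal.tendsto_ofReal (tendsto_const_nhds.congr' ?_)
    filter_upwards [tendsto_natCast_atTop_atTop.eventually_ge_atTop |a|] with n hn
    exact (min_eq_left hn).symm
  have hden : Tendsto (fun n : ℕ => ENNReal.ofReal (max b 0 + 1 / (n + 1))) atTop
      (𝓝 (ENNReal.ofReal b)) := by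
    simpa using ENNReal.tendsto_ofReal
      (tendsto_one_div_add_atTop_nhds_zero_nat.const_add (max b 0))
  refine (Tendsto.congr (fun n => ?_) (ENNReal.Tendsto.div (hnum.ennrpow_const p) (Or.inl ?_)
    (hden.ennrpow_const (p - 1)) (Or.inl ?_))).liminf_eq.ge
  · have : 0 < max b 0 + 1 / ((n : ℝ) + 1) := add_pos_of_nonneg_of_pos (le_max_right _ _) (hε n)
    rw [piconeFun, ENNReal.ofReal_div_of_pos (by positivity), ENNReal.ofReal_rpow_of_nonneg
      (le_min (abs_nonneg _) n.cast_nonneg) hp0.le, ENNReal.ofReal_rpow_of_pos this]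
  · simp [ha]
  · exact ENNReal.rpow_ne_top_of_nonneg hp'.le ENNReal.ofReal_ne_top

end Picone

/-! ### The torsion function and the first eigenvalue -/

section Torsion

variable {N : ℕ} {s p : ℝ} {Ω : Set (E N)} {u φ e : E N → ℝ}

lemma IsTorsionFunction.fracPairing_eq_integral (hφ : IsTorsionFunction s p Ω φ)
    (hu : MemW0 s p Ω u) :
    fracPairing s p φ u = ∫ x in Ω, u x := by
  simpa using hφ.weak u hu

lemma IsNormalizedFirstEigenfunction.ae_le_one (he : IsNormalizedFirstEigenfunction s p Ω e) :
    ∀ᵐ x ∂(volume.restrict Ω), e x ≤ 1 := by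
  have hbound : ∀ᵐ x ∂(volume.restrict Ω), ‖e x‖ₑ ≤ 1 := by
    rw [← he.norm_eq_one, eLpNorm_exponent_top]
    exact enorm_ae_le_eLpNormEssSup _ _
  filter_upwards [hbound] with x hx
  exact ENNReal.ofReal_le_one.1 ((Real.ofReal_le_enorm _).trans hx)

variable [NeZero N]

lemma firstEigenvalue_mul_eLpNorm_rpow_le (hs : s ∈ Set.Ioo (0 : ℝ) 1) (hp : 1 ≤ p)
    (hu : MemW0 s p Ω u) :
    firstEigenvalue s p Ω * eLpNorm u (ENNReal.ofReal p) (volume.restrict Ω) ^ p ≤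
      gagliardoPow s p u := by
  have hp0 : 0 < p := one_pos.trans_le hp
  set m := eLpNorm u (ENNReal.ofReal p) (volume.restrict Ω)
  have hm_top : m ≠ ⊤ := ((hu.memLp hp0).restrict Ω).2.ne
  rcases eq_or_ne m 0 with hm | hm
  · simp [hm, hp0]
  set c : ℝ := m.toReal⁻¹
  have hc : ‖c‖ₑ = m⁻¹ := by
    rw [enorm_inv (ENNReal.toReal_ne_zero.2 ⟨hm, hm_top⟩), Real.enorm_of_nonneg
      ENNReal.toReal_nonneg, ENNReal.ofReal_toReal hm_top]
  have hnormalized : eLpNorm (fun x => c * u x) (ENNReal.ofReal p) (volume.restrict Ω) = 1 := by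
    refine (eLpNorm_const_smul c u _ _).trans ?_
    rw [hc, ENNReal.inv_mul_cancel hm hm_top]
  have hle : firstEigenvalue s p Ω ≤ gagliardoPow s p fun x => c * u x :=
    sInf_le ⟨_, hu.const_mul hs hp c, hnormalized, rfl⟩
  rw [gagliardoPow_const_mul hp0, hc, ENNReal.inv_rpow, mul_comm, ← div_eq_mul_inv] at hle
  exact ENNReal.mul_le_of_le_div hle

namespace IsTorsionFunction

lemma nonneg (hs : s ∈ Set.Ioo (0 : ℝ) 1) (hp : 1 < p) (hφ : IsTorsionFunction s p Ω φ) :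
    ∀ᵐ x, 0 ≤ φ x := by
  have hzero : MemW0 s p Ω fun _ => 0 := MemW0.zero (one_pos.trans hp)
  refine ae_le_of_fracPairing_le hs hp hzero hφ.memW0 ?_
  rw [hφ.fracPairing_eq_integral (hzero.posPart_sub hs hp.le hφ.memW0)]
  calc fracPairing s p (fun _ => 0) _ = 0 := by simp [fracPairing]
    _ ≤ _ := integral_nonneg fun x => le_max_right _ _

theorem lintegral_rpow_div_rpow_le_gagliardoPow (hs : s ∈ Set.Ioo (0 : ℝ) 1) (hp : 1 < p)
    (hΩ : volume Ω < ⊤) (hφ : IsTorsionFunction s p Ω φ) (hu : MemW0 s p Ω u) :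
    ∫⁻ x in Ω, ‖u x‖ₑ ^ p / ENNReal.ofReal (φ x) ^ (p - 1) ≤ gagliardoPow s p u := by
  have hε : ∀ n : ℕ, (0 : ℝ) < 1 / (n + 1) := fun n => Nat.one_div_pos_of_nat
  have hmem : ∀ n : ℕ, MemW0 s p Ω fun x => piconeFun p n (1 / (n + 1)) (u x, φ x) := fun n =>
    hu.comp_piconeFun hs hp.le n.cast_nonneg (hε n) hφ.memW0
  have htest : ∀ n : ℕ,
      ∫⁻ x in Ω, ENNReal.ofReal (piconeFun p n (1 / (n + 1)) (u x, φ x)) ≤ gagliardoPow s p u := by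
    intro n
    rw [← ofReal_integral_eq_lintegral_ofReal ((hmem n).integrableOn hp.le hΩ)
      (.of_forall fun x => piconeFun_nonneg n.cast_nonneg (hε n).le _),
      ← hφ.fracPairing_eq_integral (hmem n)]
    exact fracPairing_piconeFun_le hs hp n.cast_nonneg (hε n) hu hφ.memW0 (hφ.nonneg hs hp)
  calc ∫⁻ x in Ω, ‖u x‖ₑ ^ p / ENNReal.ofReal (φ x) ^ (p - 1)
      ≤ ∫⁻ x in Ω, liminf (fun n : ℕ =>
          ENNReal.ofReal (piconeFun p n (1 / (n + 1)) (u x, φ x))) atTop :=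
        lintegral_mono fun x => rpow_div_rpow_le_liminf_piconeFun hp _ _
    _ ≤ liminf (fun n : ℕ =>
          ∫⁻ x in Ω, ENNReal.ofReal (piconeFun p n (1 / (n + 1)) (u x, φ x))) atTop :=
        lintegral_liminf_le' fun n => (hmem n).1.aemeasurable.restrict.ennreal_ofReal
    _ ≤ gagliardoPow s p u := liminf_le_of_le (by isBoundedDefault) fun b hb =>
        let ⟨n, hn⟩ := hb.exists; hn.trans (htest n)

lemma pos_of_testFunction_ne_zero {ψ : E N → ℝ} (hs : s ∈ Set.Ioo (0 : ℝ) 1) (hp : 1 < p)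
    (hΩ : volume Ω < ⊤) (hφ : IsTorsionFunction s p Ω φ) (hψ : IsTestFunction Ω ψ) :
    ∀ᵐ x ∂(volume.restrict Ω), ψ x ≠ 0 → 0 < φ x := by
  have hp0 : 0 < p := one_pos.trans hp
  have hmeas : AEMeasurable (fun x => ‖ψ x‖ₑ ^ p / ENNReal.ofReal (φ x) ^ (p - 1))
      (volume.restrict Ω) :=
    (hψ.aestronglyMeasurable.restrict.enorm.pow_const p).div
      (hφ.memW0.1.aemeasurable.restrict.ennreal_ofReal.pow_const (p - 1))
  have hfin := (hφ.lintegral_rpow_div_rpow_le_gagliardoPow hs hp hΩ (hψ.memW0 hp0)).trans_lt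
    (hψ.gagliardoPow_lt_top hs hp0)
  filter_upwards [ae_lt_top' hmeas hfin.ne] with x hx hψx
  contrapose! hx
  simp [ENNReal.ofReal_of_nonpos hx, ENNReal.zero_rpow_of_pos (sub_pos.2 hp),
    ENNReal.div_zero, hψx]

theorem pos (hs : s ∈ Set.Ioo (0 : ℝ) 1) (hp : 1 < p) (hΩ_open : IsOpen Ω)
    (hΩ : volume Ω < ⊤) (hφ : IsTorsionFunction s p Ω φ) :
    ∀ᵐ x ∂(volume.restrict Ω), 0 < φ x := by
  rw [ae_restrict_iff' hΩ_open.measurableSet, ae_iff]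
  refine measure_null_of_locally_null _ fun x hx => ?_
  have hxΩ : x ∈ Ω := (Classical.not_imp.1 hx).1
  obtain ⟨ψ, hψ_subset, hψ_compact, hψ_smooth, -, hψx⟩ :=
    exists_contDiff_tsupport_subset (n := ⊤) (hΩ_open.mem_nhds hxΩ)
  have hψ_nhds : {y | ψ y ≠ 0} ∈ 𝓝 x :=
    (isOpen_ne_fun hψ_smooth.continuous continuous_const).mem_nhds (by simp [hψx])
  refine ⟨_, inter_mem_nhdsWithin _ hψ_nhds, ?_⟩
  have hpos := hφ.pos_of_testFunction_ne_zero hs hp hΩ ⟨hψ_smooth, hψ_compact, hψ_subset⟩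
  rw [ae_restrict_iff' hΩ_open.measurableSet, ae_iff] at hpos
  refine measure_mono_null ?_ hpos
  rintro y hy h
  exact hy.1 fun hyΩ => h hyΩ hy.2

theorem one_div_eLpNorm_top_rpow_le_firstEigenvalue (hs : s ∈ Set.Ioo (0 : ℝ) 1) (hp : 1 < p)
    (hΩ : volume Ω < ⊤) (hφ : IsTorsionFunction s p Ω φ) :
    1 / eLpNorm φ ⊤ (volume.restrict Ω) ^ (p - 1) ≤ firstEigenvalue s p Ω := by
  refine le_sInf ?_
  rintro _ ⟨u, hu, hu_norm, rfl⟩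
  set M := eLpNorm φ ⊤ (volume.restrict Ω) with hM
  have hφM : ∀ᵐ x ∂(volume.restrict Ω), ENNReal.ofReal (φ x) ≤ M := by
    rw [hM, eLpNorm_exponent_top]
    exact enorm_ae_le_eLpNormEssSup φ _ |>.mono fun x hx => (Real.ofReal_le_enorm _).trans hx
  calc 1 / M ^ (p - 1) = ∫⁻ x in Ω, ‖u x‖ₑ ^ p / M ^ (p - 1) := by
        simp only [div_eq_mul_inv]
        rw [lintegral_mul_const'' _ (hu.1.restrict.enorm.pow_const p),
          ← eLpNorm_ofReal_rpow (one_pos.trans hp), hu_norm, ENNReal.one_rpow]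
    _ ≤ ∫⁻ x in Ω, ‖u x‖ₑ ^ p / ENNReal.ofReal (φ x) ^ (p - 1) :=
        lintegral_mono_ae (hφM.mono fun x hx =>
          ENNReal.div_le_div_left (ENNReal.rpow_le_rpow hx (sub_pos.2 hp).le) _)
    _ ≤ gagliardoPow s p u := hφ.lintegral_rpow_div_rpow_le_gagliardoPow hs hp hΩ hu

lemma gagliardoPow_eq_eLpNorm_one (hs : s ∈ Set.Ioo (0 : ℝ) 1) (hp : 1 < p)
    (hΩ : volume Ω < ⊤) (hφ : IsTorsionFunction s p Ω φ) :
    gagliardoPow s p φ = eLpNorm φ 1 (volume.restrict Ω) := by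
  have hp0 : 0 < p := one_pos.trans hp
  rw [gagliardoPow_eq_ofReal_fracPairing_self hp0 (hφ.memW0.memLp_increment hs hp0),
    hφ.fracPairing_eq_integral hφ.memW0, ofReal_integral_eq_eLpNorm_one
      (hφ.memW0.integrableOn hp.le hΩ) (ae_restrict_of_ae (hφ.nonneg hs hp))]

theorem firstEigenvalue_le (hs : s ∈ Set.Ioo (0 : ℝ) 1) (hp : 1 < p) (hΩ_open : IsOpen Ω)
    (hΩ_nonempty : Ω.Nonempty) (hΩ : volume Ω < ⊤) (hφ : IsTorsionFunction s p Ω φ) :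
    firstEigenvalue s p Ω ≤
      volume Ω ^ (p - 1) / eLpNorm φ 1 (volume.restrict Ω) ^ (p - 1) := by
  have hp' : 0 < p - 1 := sub_pos.2 hp
  have : NeZero (volume.restrict Ω) :=
    ⟨Measure.restrict_eq_zero.not.2 (hΩ_open.measure_pos volume hΩ_nonempty).ne'⟩
  set A := eLpNorm φ 1 (volume.restrict Ω)
  set m := eLpNorm φ (ENNReal.ofReal p) (volume.restrict Ω)
  have hφ_meas : AEStronglyMeasurable φ (volume.restrict Ω) := hφ.memW0.1.restrict
  have hA : A ≠ 0 := eLpNorm_ne_zero_of_ae_pos hφ_meas (hφ.pos hs hp hΩ_open hΩ) one_ne_zero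
  have hA_top : A ≠ ⊤ := (memLp_one_iff_integrable.2 (hφ.memW0.integrableOn hp.le hΩ)).2.ne
  have hA_rpow : A ^ p = A ^ (p - 1) * A := by
    simpa using ENNReal.rpow_add (p - 1) 1 hA hA_top
  have hholder : A ^ p ≤ m ^ p * volume Ω ^ (p - 1) := by
    simpa using eLpNorm_one_rpow_le hp.le hφ_meas
  have hmul : A * (firstEigenvalue s p Ω * A ^ (p - 1)) ≤ A * volume Ω ^ (p - 1) :=
    calc A * (firstEigenvalue s p Ω * A ^ (p - 1))
        = firstEigenvalue s p Ω * A ^ p := by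
          rw [mul_left_comm, mul_comm A, hA_rpow]
      _ ≤ firstEigenvalue s p Ω * (m ^ p * volume Ω ^ (p - 1)) := by gcongr
      _ = firstEigenvalue s p Ω * m ^ p * volume Ω ^ (p - 1) := (mul_assoc _ _ _).symm
      _ ≤ gagliardoPow s p φ * volume Ω ^ (p - 1) := by
          gcongr
          exact firstEigenvalue_mul_eLpNorm_rpow_le hs hp.le hφ.memW0
      _ = A * volume Ω ^ (p - 1) := by rw [hφ.gagliardoPow_eq_eLpNorm_one hs hp hΩ]
  rw [ENNReal.le_div_iff_mul_le (Or.inl (ENNReal.rpow_pos (pos_iff_ne_zero.2 hA) hA_top).ne')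
    (Or.inl (ENNReal.rpow_ne_top_of_nonneg hp'.le hA_top))]
  exact (ENNReal.mul_le_mul_iff_right hA hA_top).1 hmul

end IsTorsionFunction

theorem IsNormalizedFirstEigenfunction.le_torsionFunction (hs : s ∈ Set.Ioo (0 : ℝ) 1) (hp : 1 < p)
    (hΩ : volume Ω < ⊤) (he : IsNormalizedFirstEigenfunction s p Ω e)
    (hφ : IsTorsionFunction s p Ω φ) :
    ∀ᵐ x, e x ≤ (firstEigenvalue s p Ω).toReal ^ (1 / (p - 1)) * φ x := by
  have hp' : 0 < p - 1 := sub_pos.2 hp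
  set l := (firstEigenvalue s p Ω).toReal
  have hl : 0 ≤ l := ENNReal.toReal_nonneg
  have he_mem := he.isWeakSolution.memW0
  have hcφ : MemW0 s p Ω fun x => l ^ (1 / (p - 1)) * φ x := hφ.memW0.const_mul hs hp.le _
  have hw := he_mem.posPart_sub hs hp.le hcφ
  refine ae_le_of_fracPairing_le hs hp he_mem hcφ ?_
  set w : E N → ℝ := fun x => max (e x - l ^ (1 / (p - 1)) * φ x) 0
  have hw0 : ∀ x, 0 ≤ w x := fun x => le_max_right _ _
  calc fracPairing s p e w = ∫ x in Ω, l * e x ^ (p - 1) * w x := he.isWeakSolution.weak _ hw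
    _ ≤ ∫ x in Ω, l * w x := by
        refine integral_mono_of_nonneg ?_ ((hw.integrableOn hp.le hΩ).const_mul l) ?_
        · filter_upwards [he.pos] with x hx
          exact mul_nonneg (by positivity) (hw0 x)
        · filter_upwards [he.pos, he.ae_le_one] with x hx hx1
          exact mul_le_mul_of_nonneg_right
            (mul_le_of_le_one_right hl (Real.rpow_le_one hx.le hx1 hp'.le)) (hw0 x)
    _ = l * fracPairing s p φ w := by
        rw [integral_const_mul, hφ.fracPairing_eq_integral hw]
    _ = fracPairing s p (fun x => l ^ (1 / (p - 1)) * φ x) w := by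
        rw [fracPairing_const_mul_left hp.ne' (by positivity), ← Real.rpow_mul hl,
          one_div_mul_cancel hp'.ne', Real.rpow_one]

end Torsion

end FracTorsion

end

theorem mainTheorem5_general {N : ℕ} [NeZero N] {s p : ℝ} (hs : s ∈ Set.Ioo (0 : ℝ) 1)
    (hp : 1 < p) {Ω : Set (FracTorsion.E N)} (hΩ_open : IsOpen Ω) (hΩ_nonempty : Ω.Nonempty)
    (hΩ : volume Ω < ⊤) {φ : FracTorsion.E N → ℝ} (hφ : FracTorsion.IsTorsionFunction s p Ω φ) :
    (∀ e : FracTorsion.E N → ℝ, FracTorsion.IsNormalizedFirstEigenfunction s p Ω e →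
      ∀ᵐ x ∂(volume.restrict Ω),
        e x ≤ (FracTorsion.firstEigenvalue s p Ω).toReal ^ (1 / (p - 1)) * φ x) ∧
    1 / eLpNorm φ ⊤ (volume.restrict Ω) ^ (p - 1) ≤ FracTorsion.firstEigenvalue s p Ω ∧
    FracTorsion.firstEigenvalue s p Ω ≤
      volume Ω ^ (p - 1) / eLpNorm φ 1 (volume.restrict Ω) ^ (p - 1) ∧
    ∀ᵐ x ∂(volume.restrict Ω), 0 < φ x :=
  ⟨fun _ he => ae_restrict_of_ae (he.le_torsionFunction hs hp hΩ hφ),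
    hφ.one_div_eLpNorm_top_rpow_le_firstEigenvalue hs hp hΩ,
    hφ.firstEigenvalue_le hs hp hΩ_open hΩ_nonempty hΩ,
    hφ.pos hs hp hΩ_open hΩ⟩

theorem mainTheorem5 (N : ℕ) (hN : 2 ≤ N) (s p : ℝ) (hs0 : 0 < s) (hs1 : s < 1)
    (hp1 : 1 < p) (hpN : p < (N : ℝ) / s)
    (Ω : Set (FracTorsion.E N)) (hΩ : FracTorsion.IsBoundedLipschitzDomain Ω)
    (φ : FracTorsion.E N → ℝ) (hφ : FracTorsion.IsTorsionFunction s p Ω φ) :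
    (∀ e : FracTorsion.E N → ℝ, FracTorsion.IsNormalizedFirstEigenfunction s p Ω e →
      ∀ᵐ x ∂(volume.restrict Ω),
        e x ≤ (FracTorsion.firstEigenvalue s p Ω).toReal ^ (1 / (p - 1)) * φ x) ∧
    1 / eLpNorm φ ⊤ (volume.restrict Ω) ^ (p - 1) ≤ FracTorsion.firstEigenvalue s p Ω ∧
    FracTorsion.firstEigenvalue s p Ω ≤
      volume Ω ^ (p - 1) / eLpNorm φ 1 (volume.restrict Ω) ^ (p - 1) ∧
    ∀ᵐ x ∂(volume.restrict Ω), 0 < φ x := by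
  have : NeZero N := ⟨by omega⟩
  exact mainTheorem5_general ⟨hs0, hs1⟩ hp1 hΩ.isOpen hΩ.isConnected.nonempty
    hΩ.isBounded.measure_lt_top hφ
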